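/- Let $(\Xi,\mathcal A,\mathbb P)$ be a probability space, let $n\ge 1$, and let $\Omega\subset\mathbb R^n$ be a bounded Lipschitz domain. Let $a:\Omega\times\Xi\to\mathbb R$ be such that $a(x,\cdot)$ is measurable for every $x\in\Omega$, $a(\cdot,\xi)$ is Lebesgue measurable for almost every $\xi\in\Xi$, and there are real numbers $a_*,a^*>0$ such that, for almost every $\xi\in\Xi$, $$a_*\le a(x,\xi)\le a^*\qquad\text{for almost every }x\in\Omega .$$ Then for almost every $\xi\in\Xi$ and every $z\in L^2(\Omega)$ there is exactly one $u\in H^1_0(\Omega)$, denoted $s(\xi,z)$, with $$\int_\Omega a(x,\xi)\,\nabla u(x)\cdot\nabla v(x)\,dx=\int_\Omega z(x)v(x)\,dx\qquad\text{for all }v\in H^1_0(\Omega),$$ that is, the weak solution of $-\nabla\cdot(a(\cdot,\xi)\nabla u)=z$ in $\Omega$, $u=0$ on $\partial\Omega$. (For those $\xi$ for which $a(\cdot,\xi)$ is not measurable or is not bounded above and below a.e. by positive constants, set $s(\xi,z)=0$.) 1. If $(z_\epsilon)_{\epsilon>0}\subset L^2(\Omega)$, $z\in L^2(\Omega)$ and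 $z_\epsilon\rightharpoonup z$ weakly in $L^2(\Omega)$ as $\epsilon\downarrow 0$, then, for almost every $\xi\in\Xi$, $s(\xi,z_\epsilon)\to s(\xi,z)$ strongly in $H^1_0(\Omega)$ as $\epsilon\downarrow 0$. 2. If moreover $a$ is jointly measurable on $\Omega\times\Xi$ (with respect to the product of the Borel $\sigma$-algebra of $\Omega$ and $\mathcal A$), then $s$ satisfies the following two conditions: (i) $s(\cdot,z):\Xi\to H^1_0(\Omega)$ is $\mathcal A$-measurable for every $z\in L^2(\Omega)$; (ii) whenever $z_\epsilon\rightharpoonup z$ weakly in $L^2(\Omega)$ as $\epsilon\downarrow0$, $s(\xi,z_\epsilon)\rightharpoonup s(\xi,z)$ weakly in $H^1_0(\Omega)$ for almost every $\xi\in\Xi$. -/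

import Mathlib

open MeasureTheory Filter Topology
open scoped ContDiff

/-- A bounded Lipschitz domain of `ℝⁿ`: a bounded, nonempty, connected open set which near each
boundary point is, for a suitable unit vector `ν`, the set of points lying strictly above the graph
of a Lipschitz function over the hyperplane `ν^⊥`; here `y - ⟨ν, y⟩ ν` is the projection of `y`
to that hyperplane and `⟨ν, y⟩` its height. -/
structure IsBoundedLipschitzDomain {n : ℕ} (Ω : Set (EuclideanSpace ℝ (Fin n))) : Prop where
  isOpen : IsOpen Ω
  isConnected : IsConnected Ω
  isBounded : Bornology.IsBounded Ω
  lipschitz_boundary : ∀ x ∈ frontier Ω, ∃ ν : EuclideanSpace ℝ (Fin n), ‖ν‖ = 1 ∧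
    ∃ r : ℝ, 0 < r ∧ ∃ (K : NNReal) (γ : EuclideanSpace ℝ (Fin n) → ℝ), LipschitzWith K γ ∧
      ∀ y ∈ Metric.ball x r, y ∈ Ω ↔ γ (y - inner ℝ ν y • ν) < inner ℝ ν y

/-- The real Hilbert space `L²(Ω)`. -/
abbrev L2 {n : ℕ} (Ω : Set (EuclideanSpace ℝ (Fin n))) : Type :=
  Lp ℝ 2 (volume.restrict Ω)

/-- The Hilbert space `L²(Ω) × L²(Ω; ℝⁿ)` with the norm `(‖u‖² + ‖g‖²)^(1/2)`. The Sobolev space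
`H¹(Ω)` sits isometrically in it through `u ↦ (u, ∇u)`. -/
abbrev SobolevPair {n : ℕ} (Ω : Set (EuclideanSpace ℝ (Fin n))) : Type :=
  WithLp 2 (Lp ℝ 2 (volume.restrict Ω) × Lp (EuclideanSpace ℝ (Fin n)) 2 (volume.restrict Ω))

/-- The pairs `(φ, ∇φ)` of classes in `L²`, for `φ` smooth with compact support inside `Ω`. -/
def testPairs {n : ℕ} (Ω : Set (EuclideanSpace ℝ (Fin n))) : Set (SobolevPair Ω) :=
  {w | ∃ φ : EuclideanSpace ℝ (Fin n) → ℝ,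
    ContDiff ℝ ∞ φ ∧ HasCompactSupport φ ∧ tsupport φ ⊆ Ω ∧
      w.fst =ᵐ[volume.restrict Ω] φ ∧ w.snd =ᵐ[volume.restrict Ω] gradient φ}

/-- The Sobolev space `H¹₀(Ω)`: the closure of `C_c^∞(Ω)` in the norm of `H¹(Ω)`, each element
`u` being carried together with its weak gradient. -/
noncomputable def H10 {n : ℕ} (Ω : Set (EuclideanSpace ℝ (Fin n))) :
    Submodule ℝ (SobolevPair Ω) :=
  (Submodule.span ℝ (testPairs Ω)).topologicalClosure

/-- The `L²` function underlying an element of `H¹₀(Ω)`. -/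
noncomputable def H10.val {n : ℕ} {Ω : Set (EuclideanSpace ℝ (Fin n))} (u : H10 Ω) : L2 Ω :=
  (u : SobolevPair Ω).fst

/-- The weak gradient of an element of `H¹₀(Ω)`. -/
noncomputable def H10.grad {n : ℕ} {Ω : Set (EuclideanSpace ℝ (Fin n))} (u : H10 Ω) :
    Lp (EuclideanSpace ℝ (Fin n)) 2 (volume.restrict Ω) :=
  (u : SobolevPair Ω).snd

/-- `u ∈ H¹₀(Ω)` is the weak solution of `-∇·(b ∇u) = z` in `Ω`, `u = 0` on `∂Ω`. -/
def IsWeakSolution {n : ℕ} (Ω : Set (EuclideanSpace ℝ (Fin n)))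
    (b : EuclideanSpace ℝ (Fin n) → ℝ) (z : L2 Ω) (u : H10 Ω) : Prop :=
  ∀ v : H10 Ω,
    ∫ x in Ω, b x * inner ℝ (H10.grad u x) (H10.grad v x) = ∫ x in Ω, z x * H10.val v x

/-- A measurable coefficient that is a.e. bounded above and below by positive constants. -/
def IsUniformlyElliptic {n : ℕ} (Ω : Set (EuclideanSpace ℝ (Fin n)))
    (b : EuclideanSpace ℝ (Fin n) → ℝ) : Prop :=
  AEMeasurable b (volume.restrict Ω) ∧
    ∃ c C : ℝ, 0 < c ∧ 0 < C ∧ ∀ᵐ x ∂(volume.restrict Ω), c ≤ b x ∧ b x ≤ C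

open Classical in
/-- The solution operator `s(ξ, z)`: the weak solution in `H¹₀(Ω)` for the coefficient
`a(·, ξ)` and the right-hand side `z`. For the exceptional `ξ` whose coefficient is not uniformly
elliptic, it is set to `0`. -/
noncomputable def solutionOperator {n : ℕ} {Ξ : Type*} (Ω : Set (EuclideanSpace ℝ (Fin n)))
    (a : EuclideanSpace ℝ (Fin n) → Ξ → ℝ) (ξ : Ξ) (z : L2 Ω) : H10 Ω :=
  if h : IsUniformlyElliptic Ω (fun x => a x ξ) ∧
      ∃ u : H10 Ω, IsWeakSolution Ω (fun x => a x ξ) z u then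
    h.2.choose
  else 0

/-- Weak convergence `y_ε ⇀ y` as `ε ↓ 0` of a family indexed by the positive reals. -/
def WeaklyConverges {Y : Type*} [NormedAddCommGroup Y] [NormedSpace ℝ Y]
    (y_ε : ℝ → Y) (y : Y) : Prop :=
  Tendsto (fun ε => toWeakSpace ℝ Y (y_ε ε)) (𝓝[>] (0 : ℝ)) (𝓝 (toWeakSpace ℝ Y y))

/-- The standing assumption on a solution map `s : Ξ × Z → U`: measurability in `ξ` for every
control, and almost sure weak-to-weak sequential continuity in the control. -/
structure SolutionMapAssumption {Ξ Z U : Type*} [MeasurableSpace Ξ] (P : Measure Ξ)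
    [NormedAddCommGroup Z] [NormedSpace ℝ Z] [NormedAddCommGroup U] [NormedSpace ℝ U]
    (s : Ξ → Z → U) : Prop where
  measurable : ∀ z : Z, StronglyMeasurable fun ξ => s ξ z
  weakly_continuous : ∀ (z_ε : ℝ → Z) (z : Z), WeaklyConverges z_ε z →
    ∀ᵐ ξ ∂P, WeaklyConverges (fun ε => s ξ (z_ε ε)) (s ξ z)

/-!
For a coefficient `b` with `c ≤ b ≤ C`, the energy form `∫ b ∇u·∇v` is bounded on `H¹₀(Ω)` and, by
the Poincaré inequality (`exists_norm_val_le`), coercive. The Lax–Milgram theorem then gives a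
continuous linear solution operator `S : L²(Ω) → H¹₀(Ω)` (`exists_continuousLinear_solution`), and
`κ ‖S z‖² ≤ ⟨z, S z⟩` with the pairing of `L²(Ω)`.

Both the Poincaré inequality and Rellich's theorem come from one estimate for test functions,
`‖φ(· + y) - φ‖ ≤ ‖y‖ ‖∇φ‖` in `L²` (`lintegral_enorm_sub_sq_le`). If `y` is longer than the
diameter of `Ω`, then `φ` and its translate have disjoint supports, which is Poincaré's inequality.
If `y` is averaged over a small ball, then `φ` is within `h ‖∇φ‖` of its mean over balls of radius
`h`. Along a weakly null sequence these means tend to zero pointwise and boundedly, so the sequence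
tends to zero in `L²(Ω)` when its gradients are bounded (`tendsto_norm_val_of_weak`).

If `w_k ⇀ 0` in `L²(Ω)`, then `S w_k` is bounded in `H¹₀(Ω)` and weakly null in `L²(Ω)`, hence null
in `L²(Ω)`; since `(w_k)` is bounded, `κ ‖S w_k‖² ≤ ⟨w_k, S w_k⟩ → 0`. This is the strong
convergence of the states, and it contains the weak one.

Measurability in the parameter `ξ` uses the separability of `H¹₀(Ω)`. By coercivity, the solution
lies in an open set `U` exactly if, for some `d` of a countable dense set, the residual of `d` is so
small that a ball around `d` which must contain the solution is inside `U`
(`mem_iff_exists_residual_le`). The residual is tested against countably many functions only, and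
each such test is measurable in `ξ` by Fubini's theorem.
-/

/-! ### Averages and translates of smooth functions -/

lemma enorm_integral_sq_le {α : Type*} [MeasurableSpace α] {ν : Measure α}
    [IsProbabilityMeasure ν] {f : α → ℝ} (hf : AEStronglyMeasurable f ν) :
    ‖∫ x, f x ∂ν‖ₑ ^ 2 ≤ ∫⁻ x, ‖f x‖ₑ ^ 2 ∂ν := by
  have h1 : ‖∫ x, f x ∂ν‖ₑ ≤ eLpNorm f 2 ν := by
    refine (enorm_integral_le_lintegral_enorm f).trans ?_
    rw [← eLpNorm_one_eq_lintegral_enorm]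
    exact eLpNorm_le_eLpNorm_of_exponent_le (by norm_num) hf
  have h2 := eLpNorm_nnreal_pow_eq_lintegral (μ := ν) (f := f) (p := 2) (by norm_num)
  simp only [NNReal.coe_ofNat, ENNReal.rpow_ofNat, ENNReal.coe_ofNat] at h2
  rw [← h2]
  gcongr

lemma enorm_sq_le_two_mul (s t : ℝ) : ‖s‖ₑ ^ 2 ≤ 2 * ‖t - s‖ₑ ^ 2 + 2 * ‖t‖ₑ ^ 2 := by
  have h : s ^ 2 ≤ 2 * (t - s) ^ 2 + 2 * t ^ 2 := by nlinarith [sq_nonneg (2 * t - s)]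
  have e : ∀ r : ℝ, ‖r‖ₑ ^ 2 = ENNReal.ofReal (r ^ 2) := fun r => by
    rw [← ofReal_norm, ← ENNReal.ofReal_pow (norm_nonneg _), Real.norm_eq_abs, sq_abs]
  have e2 : (2 : ENNReal) = ENNReal.ofReal 2 := by simp
  rw [e, e, e, e2, ← ENNReal.ofReal_mul (by norm_num), ← ENNReal.ofReal_mul (by norm_num),
    ← ENNReal.ofReal_add (by positivity) (by positivity)]
  exact ENNReal.ofReal_le_ofReal h

section Translation

variable {E : Type*} [NormedAddCommGroup E] [InnerProductSpace ℝ E] [FiniteDimensional ℝ E]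

lemma continuous_gradient {φ : E → ℝ} (hφ : ContDiff ℝ 1 φ) : Continuous (gradient φ) :=
  (InnerProductSpace.toDual ℝ E).symm.continuous.comp (hφ.continuous_fderiv (by norm_num))

lemma enorm_sub_sq_le_lintegral_gradient {φ : E → ℝ} (hφ : ContDiff ℝ 1 φ) (x y : E) :
    ‖φ (x + y) - φ x‖ₑ ^ 2 ≤
      ‖y‖ₑ ^ 2 * ∫⁻ t in Set.Ioc (0 : ℝ) 1, ‖gradient φ (x + t • y)‖ₑ ^ 2 := by
  have hc : Continuous fun t : ℝ => inner ℝ (gradient φ (x + t • y)) y :=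
    ((continuous_gradient hφ).comp (by fun_prop)).inner continuous_const
  have hd : ∀ t : ℝ, HasDerivAt (fun t : ℝ => φ (x + t • y))
      (inner ℝ (gradient φ (x + t • y)) y) t := by
    intro t
    have h1 : HasDerivAt (fun t : ℝ => x + t • y) y t := by
      simpa using ((hasDerivAt_id t).smul_const y).const_add x
    have h2 := ((hφ.differentiable (by norm_num)) (x + t • y)).hasFDerivAt
    rw [inner_gradient_left]
    exact h2.comp_hasDerivAt t h1
  have hI : φ (x + y) - φ x = ∫ t in Set.Ioc (0 : ℝ) 1, inner ℝ (gradient φ (x + t • y)) y := by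
    rw [← intervalIntegral.integral_of_le zero_le_one,
      intervalIntegral.integral_eq_sub_of_hasDerivAt (fun t _ => hd t)
        (hc.intervalIntegrable 0 1)]
    simp
  have : IsProbabilityMeasure (volume.restrict (Set.Ioc (0 : ℝ) 1)) := ⟨by simp⟩
  rw [hI, ← lintegral_const_mul']
  · refine (enorm_integral_sq_le hc.aestronglyMeasurable).trans (lintegral_mono fun t => ?_)
    rw [← mul_pow, mul_comm]
    gcongr
    rw [enorm_eq_nnnorm, enorm_eq_nnnorm, enorm_eq_nnnorm, ← ENNReal.coe_mul]
    exact_mod_cast nnnorm_inner_le_nnnorm _ _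
  · finiteness

variable [MeasurableSpace E] [BorelSpace E] {μ : Measure E} [μ.IsAddHaarMeasure]

/-- Translating by `y` moves a function by at most `‖y‖` times the `L²` norm of its gradient. -/
lemma lintegral_enorm_sub_sq_le {φ : E → ℝ} (hφ : ContDiff ℝ 1 φ) (y : E) :
    ∫⁻ x, ‖φ (x + y) - φ x‖ₑ ^ 2 ∂μ ≤ ‖y‖ₑ ^ 2 * ∫⁻ x, ‖gradient φ x‖ₑ ^ 2 ∂μ := by
  have hg := continuous_gradient hφ
  calc ∫⁻ x, ‖φ (x + y) - φ x‖ₑ ^ 2 ∂μ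
      ≤ ∫⁻ x, (‖y‖ₑ ^ 2 * ∫⁻ t in Set.Ioc (0 : ℝ) 1, ‖gradient φ (x + t • y)‖ₑ ^ 2) ∂μ :=
        lintegral_mono fun x => enorm_sub_sq_le_lintegral_gradient hφ x y
    _ = ‖y‖ₑ ^ 2 * ∫⁻ x, (∫⁻ t in Set.Ioc (0 : ℝ) 1, ‖gradient φ (x + t • y)‖ₑ ^ 2) ∂μ :=
        lintegral_const_mul' _ _ (by finiteness)
    _ = ‖y‖ₑ ^ 2 * ∫⁻ t in Set.Ioc (0 : ℝ) 1, ∫⁻ x, ‖gradient φ (x + t • y)‖ₑ ^ 2 ∂μ := by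
        rw [lintegral_lintegral_swap]
        refine Measurable.aemeasurable (Continuous.measurable ?_)
        have : Continuous fun p : E × ℝ => gradient φ (p.1 + p.2 • y) :=
          hg.comp (by fun_prop)
        exact (ENNReal.continuous_pow 2).comp this.enorm
    _ = ‖y‖ₑ ^ 2 * ∫⁻ x, ‖gradient φ x‖ₑ ^ 2 ∂μ := by
        congr 1
        simp_rw [lintegral_add_right_eq_self (μ := μ) fun x => ‖gradient φ x‖ₑ ^ 2]
        simp

/-- A function is controlled by its gradient if some translate of it has disjoint support. -/
lemma lintegral_enorm_sq_le_gradient {φ : E → ℝ} (hφ : ContDiff ℝ 1 φ) {y : E}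
    (hy : ∀ x, φ x ≠ 0 → φ (x + y) = 0) :
    ∫⁻ x, ‖φ x‖ₑ ^ 2 ∂μ ≤ ‖y‖ₑ ^ 2 * ∫⁻ x, ‖gradient φ x‖ₑ ^ 2 ∂μ := by
  refine le_trans (lintegral_mono fun x => ?_) (lintegral_enorm_sub_sq_le hφ y)
  by_cases hx : φ x = 0
  · simp [hx]
  · simp [hy x hx]

/-- Averaging `φ` over translations of length at most `h` moves it by at most `h` times the
`L²` norm of its gradient. -/
lemma lintegral_enorm_sq_le_average {φ : E → ℝ} (hφ : ContDiff ℝ 1 φ)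
    (hc : HasCompactSupport φ) {ν : Measure E} [IsProbabilityMeasure ν] {h : ℝ}
    (hν : ∀ᵐ y ∂ν, ‖y‖ ≤ h) (s : Set E) :
    ∫⁻ x in s, ‖φ x‖ₑ ^ 2 ∂μ ≤
      2 * (ENNReal.ofReal h ^ 2 * ∫⁻ x, ‖gradient φ x‖ₑ ^ 2 ∂μ) +
        2 * ∫⁻ x in s, ‖∫ y, φ (x + y) ∂ν‖ₑ ^ 2 ∂μ := by
  have hφc := hφ.continuous
  have hm : Continuous fun p : E × E => φ (p.1 + p.2) - φ p.1 := by fun_prop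
  have hint : ∀ x, Integrable (fun y => φ (x + y)) ν := by
    intro x
    obtain ⟨C, hC⟩ := hc.exists_bound_of_continuous hφc
    exact Integrable.of_bound (by fun_prop : Continuous fun y => φ (x + y)).aestronglyMeasurable C
      (ae_of_all _ fun y => hC _)
  have hmeas : Measurable fun x => ‖(∫ y, φ (x + y) ∂ν) - φ x‖ₑ ^ 2 := by
    have h1 : StronglyMeasurable fun x => ∫ y, φ (x + y) ∂ν :=
      StronglyMeasurable.integral_prod_right (f := fun x y => φ (x + y))
        (by fun_prop : Continuous fun p : E × E => φ (p.1 + p.2)).stronglyMeasurable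
    exact ((h1.measurable.sub hφc.measurable).enorm).pow_const 2
  calc ∫⁻ x in s, ‖φ x‖ₑ ^ 2 ∂μ
      ≤ ∫⁻ x in s, (2 * ‖(∫ y, φ (x + y) ∂ν) - φ x‖ₑ ^ 2 + 2 * ‖∫ y, φ (x + y) ∂ν‖ₑ ^ 2) ∂μ :=
        lintegral_mono fun x => enorm_sq_le_two_mul _ _
    _ = 2 * ∫⁻ x in s, ‖(∫ y, φ (x + y) ∂ν) - φ x‖ₑ ^ 2 ∂μ +
          2 * ∫⁻ x in s, ‖∫ y, φ (x + y) ∂ν‖ₑ ^ 2 ∂μ := by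
        rw [lintegral_add_left (hmeas.const_mul _), lintegral_const_mul' _ _ (by finiteness),
          lintegral_const_mul' _ _ (by finiteness)]
    _ ≤ _ := by
        gcongr
        calc ∫⁻ x in s, ‖(∫ y, φ (x + y) ∂ν) - φ x‖ₑ ^ 2 ∂μ
            ≤ ∫⁻ x, ‖(∫ y, φ (x + y) ∂ν) - φ x‖ₑ ^ 2 ∂μ := setLIntegral_le_lintegral _ _
          _ ≤ ∫⁻ x, (∫⁻ y, ‖φ (x + y) - φ x‖ₑ ^ 2 ∂ν) ∂μ := by
              refine lintegral_mono fun x => ?_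
              have e : (∫ y, φ (x + y) ∂ν) - φ x = ∫ y, (φ (x + y) - φ x) ∂ν := by
                rw [integral_sub (hint x) (integrable_const _)]; simp
              rw [e]
              exact enorm_integral_sq_le
                (by fun_prop : Continuous fun y => φ (x + y) - φ x).aestronglyMeasurable
          _ = ∫⁻ y, ∫⁻ x, ‖φ (x + y) - φ x‖ₑ ^ 2 ∂μ ∂ν :=
              lintegral_lintegral_swap
                ((ENNReal.continuous_pow 2).comp hm.enorm).measurable.aemeasurable
          _ ≤ ∫⁻ y, ENNReal.ofReal h ^ 2 * ∫⁻ x, ‖gradient φ x‖ₑ ^ 2 ∂μ ∂ν := by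
              refine lintegral_mono_ae (hν.mono fun y hy => ?_)
              refine (lintegral_enorm_sub_sq_le hφ y).trans ?_
              gcongr
              rw [← ofReal_norm]
              exact ENNReal.ofReal_le_ofReal hy
          _ = _ := by simp

end Translation

/-! ### The Poincaré inequality in `H¹₀` -/

section Sobolev

lemma enorm_Lp_two_sq {α F : Type*} [MeasurableSpace α] {μ : Measure α} [NormedAddCommGroup F]
    (f : Lp F 2 μ) : ‖f‖ₑ ^ 2 = ∫⁻ x, ‖f x‖ₑ ^ 2 ∂μ := by
  have h2 := eLpNorm_nnreal_pow_eq_lintegral (μ := μ) (f := f) (p := 2) (by norm_num)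
  simp only [NNReal.coe_ofNat, ENNReal.rpow_ofNat, ENNReal.coe_ofNat] at h2
  rw [← h2, Lp.enorm_def]

variable {n : ℕ} {Ω : Set (EuclideanSpace ℝ (Fin n))}

lemma gradient_add {φ ψ : EuclideanSpace ℝ (Fin n) → ℝ} (hφ : ContDiff ℝ ∞ φ)
    (hψ : ContDiff ℝ ∞ ψ) (x : EuclideanSpace ℝ (Fin n)) :
    gradient (φ + ψ) x = gradient φ x + gradient ψ x := by
  simp only [gradient]
  rw [fderiv_add (hφ.differentiable (by simp) x) (hψ.differentiable (by simp) x), map_add]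

lemma gradient_const_smul {φ : EuclideanSpace ℝ (Fin n) → ℝ} (hφ : ContDiff ℝ ∞ φ) (c : ℝ)
    (x : EuclideanSpace ℝ (Fin n)) : gradient (c • φ) x = c • gradient φ x := by
  simp only [gradient]
  rw [fderiv_const_smul (hφ.differentiable (by simp) x), map_smulₛₗ]
  simp

/-- Test functions form a vector space, so their span adds nothing to them. -/
lemma span_testPairs : (Submodule.span ℝ (testPairs Ω) : Set (SobolevPair Ω)) = testPairs Ω := by
  let S : Submodule ℝ (SobolevPair Ω) :=
    { carrier := testPairs Ω
      zero_mem' := by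
        refine ⟨0, contDiff_const, HasCompactSupport.zero, by simp [tsupport], ?_, ?_⟩
        · exact Lp.coeFn_zero _ _ _
        · filter_upwards [Lp.coeFn_zero (EuclideanSpace ℝ (Fin n)) 2 (volume.restrict Ω)] with x hx
          rw [WithLp.zero_snd, hx]
          exact (gradient_const x (0 : ℝ)).symm
      add_mem' := by
        rintro u v ⟨φ, h1, h2, h3, h4, h5⟩ ⟨ψ, k1, k2, k3, k4, k5⟩
        refine ⟨φ + ψ, h1.add k1, h2.add k2,
          (tsupport_add φ ψ).trans (Set.union_subset h3 k3), ?_, ?_⟩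
        · exact (Lp.coeFn_add u.fst v.fst).trans (h4.add k4)
        · filter_upwards [Lp.coeFn_add u.snd v.snd, h5, k5] with x hx h k
          rw [WithLp.add_snd, hx, gradient_add h1 k1, Pi.add_apply, h, k]
      smul_mem' := by
        rintro c u ⟨φ, h1, h2, h3, h4, h5⟩
        refine ⟨c • φ, h1.const_smul c, h2.smul_left (f := fun _ => c),
          (tsupport_smul_subset_right (fun _ => c) φ).trans h3, ?_, ?_⟩
        · exact (Lp.coeFn_smul c u.fst).trans (h4.const_smul c)
        · filter_upwards [Lp.coeFn_smul c u.snd, h5] with x hx h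
          rw [WithLp.smul_snd, hx, gradient_const_smul h1, Pi.smul_apply, h] }
  exact subset_antisymm (Submodule.span_le (p := S).2 (subset_refl _)) Submodule.subset_span

lemma H10_eq_closure : (H10 Ω : Set (SobolevPair Ω)) = closure (testPairs Ω) := by
  rw [H10, Submodule.topologicalClosure_coe, span_testPairs]

lemma support_gradient_subset (φ : EuclideanSpace ℝ (Fin n) → ℝ) :
    Function.support (gradient φ) ⊆ tsupport φ := by
  intro x hx
  refine support_fderiv_subset ℝ (f := φ) fun h => hx ?_
  simp [gradient, h]

lemma enorm_sq_eq_lintegral_of_ae_eq {F : Type*} [NormedAddCommGroup F]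
    (f : Lp F 2 (volume.restrict Ω)) {g : EuclideanSpace ℝ (Fin n) → F}
    (hfg : f =ᵐ[volume.restrict Ω] g) (hg : Function.support g ⊆ Ω) :
    ‖f‖ₑ ^ 2 = ∫⁻ x, ‖g x‖ₑ ^ 2 := by
  rw [enorm_Lp_two_sq, ← setLIntegral_eq_of_support_subset (s := Ω) (f := fun x => ‖g x‖ₑ ^ 2)]
  · exact lintegral_congr_ae (by filter_upwards [hfg] with x hx; rw [hx])
  · intro x hx
    exact hg fun h => hx (by simp [h])

lemma norm_fst_le_of_mem_testPairs {y : EuclideanSpace ℝ (Fin n)} (hy : ∀ x ∈ Ω, x + y ∉ Ω)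
    {w : SobolevPair Ω} (hw : w ∈ testPairs Ω) : ‖w.fst‖ ≤ ‖y‖ * ‖w.snd‖ := by
  obtain ⟨φ, h1, h2, h3, h4, h5⟩ := hw
  have hs : Function.support φ ⊆ Ω := (subset_tsupport φ).trans h3
  have h := lintegral_enorm_sq_le_gradient (μ := volume) (h1.of_le (by simp)) (y := y) fun x hx =>
    by_contra fun hne => hy x (hs hx) (hs hne)
  rw [← enorm_sq_eq_lintegral_of_ae_eq w.fst h4 hs, ← enorm_sq_eq_lintegral_of_ae_eq w.snd h5
    ((support_gradient_subset φ).trans h3), ← mul_pow] at h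
  have h' := (ENNReal.pow_le_pow_left_iff two_ne_zero).1 h
  rw [← ofReal_norm, ← ofReal_norm, ← ofReal_norm, ← ENNReal.ofReal_mul (norm_nonneg _)] at h'
  exact (ENNReal.ofReal_le_ofReal_iff (by positivity)).1 h'

/-- The **Poincaré inequality**, from a translation that moves `Ω` off itself; such a translation
exists because the dimension is positive. -/
theorem exists_norm_val_le (hn : 0 < n) (hΩ : Bornology.IsBounded Ω) :
    ∃ C : ℝ, 0 ≤ C ∧ ∀ u : H10 Ω, ‖H10.val u‖ ≤ C * ‖H10.grad u‖ := by
  obtain ⟨R, hR, hΩR⟩ := hΩ.subset_ball_lt 0 0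
  let y : EuclideanSpace ℝ (Fin n) := EuclideanSpace.single ⟨0, hn⟩ (2 * R)
  have hyn : ‖y‖ = 2 * R := by simp [y, abs_of_pos hR]
  have hy : ∀ x ∈ Ω, x + y ∉ Ω := by
    intro x hx hxy
    have e1 : ‖x‖ < R := by simpa using hΩR hx
    have e2 : ‖x + y‖ < R := by simpa using hΩR hxy
    have e3 : ‖y‖ ≤ ‖x + y‖ + ‖x‖ := by simpa using norm_sub_le (x + y) x
    linarith
  refine ⟨‖y‖, norm_nonneg _, fun u => ?_⟩
  have hu : (u : SobolevPair Ω) ∈ closure (testPairs Ω) := H10_eq_closure ▸ u.2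
  have hcl : IsClosed {w : SobolevPair Ω | ‖w.fst‖ ≤ ‖y‖ * ‖w.snd‖} :=
    isClosed_le (by fun_prop) (by fun_prop)
  exact closure_minimal (fun w hw => norm_fst_le_of_mem_testPairs hy hw) hcl hu

/-! ### The Rellich theorem in `H¹₀` -/

/-- The indicator of the ball of radius `h` around `x`, as an element of `L²(Ω)`; pairing with it
integrates over the part of the ball that lies in `Ω`. -/
noncomputable def ballIndicator (Ω : Set (EuclideanSpace ℝ (Fin n)))
    (x : EuclideanSpace ℝ (Fin n)) (h : ℝ) : L2 Ω :=
  indicatorConstLp 2 (μ := volume.restrict Ω) (s := Metric.closedBall x h)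
    Metric.isClosed_closedBall.measurableSet
    (((Measure.restrict_apply_le Ω _).trans_lt measure_closedBall_lt_top).ne) (1 : ℝ)

lemma norm_ballIndicator_le (x : EuclideanSpace ℝ (Fin n)) (h : ℝ) :
    ‖ballIndicator Ω x h‖ ≤ volume.real (Metric.closedBall (0 : EuclideanSpace ℝ (Fin n)) h)
      ^ (1 / 2 : ℝ) := by
  rw [ballIndicator, norm_indicatorConstLp (by norm_num) (by norm_num)]
  simp only [norm_one, one_mul, ENNReal.toReal_ofNat]
  refine Real.rpow_le_rpow measureReal_nonneg ?_ (by norm_num)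
  have e : volume (Metric.closedBall (0 : EuclideanSpace ℝ (Fin n)) h) =
      volume (Metric.closedBall x h) := by
    rw [Measure.addHaar_closedBall_center volume x h]
  rw [Measure.real, Measure.real, e]
  exact ENNReal.toReal_mono measure_closedBall_lt_top.ne (Measure.restrict_apply_le Ω _)

/-- The averages of a test function over balls of radius `h` control it in `L²`, up to `h` times
the norm of its gradient. -/
lemma exists_average_of_mem_testPairs {h : ℝ} (hh : 0 < h) {w : SobolevPair Ω}
    (hw : w ∈ testPairs Ω) :
    ∃ m : EuclideanSpace ℝ (Fin n) → ℝ, Measurable m ∧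
      (∀ x, m x = (volume.real (Metric.closedBall (0 : EuclideanSpace ℝ (Fin n)) h))⁻¹ *
        inner ℝ (ballIndicator Ω x h) w.fst) ∧
      ‖w.fst‖ₑ ^ 2 ≤ 2 * (ENNReal.ofReal h ^ 2 * ‖w.snd‖ₑ ^ 2) + 2 * ∫⁻ x in Ω, ‖m x‖ₑ ^ 2 := by
  obtain ⟨φ, h1, h2, h3, h4, h5⟩ := hw
  have hs : Function.support φ ⊆ Ω := (subset_tsupport φ).trans h3
  have hφc := h1.continuous
  set B := Metric.closedBall (0 : EuclideanSpace ℝ (Fin n)) h with hB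
  have hB0 : volume B ≠ 0 := (Metric.measure_closedBall_pos volume _ hh).ne'
  have hBt : volume B ≠ ⊤ := measure_closedBall_lt_top.ne
  let ν : Measure (EuclideanSpace ℝ (Fin n)) := ProbabilityTheory.cond volume B
  have : IsProbabilityMeasure ν := ProbabilityTheory.cond_isProbabilityMeasure_of_finite hB0 hBt
  have hν : ∀ᵐ y ∂ν, ‖y‖ ≤ h := by
    refine (Measure.ae_smul_measure (ae_restrict_mem Metric.isClosed_closedBall.measurableSet) _).mono
      fun y hy => by simpa [hB] using hy
  refine ⟨fun x => ∫ y, φ (x + y) ∂ν, ?_, fun x => ?_, ?_⟩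
  · exact (StronglyMeasurable.integral_prod_right (f := fun x y => φ (x + y))
      (by fun_prop : Continuous fun p : EuclideanSpace ℝ (Fin n) × EuclideanSpace ℝ (Fin n) =>
        φ (p.1 + p.2)).stronglyMeasurable).measurable
  · have hBx : MeasurableSet (Metric.closedBall x h) := Metric.isClosed_closedBall.measurableSet
    have hBm : MeasurableSet B := Metric.isClosed_closedBall.measurableSet
    rw [ballIndicator, L2.inner_indicatorConstLp_one]
    simp only [ν, ProbabilityTheory.cond, integral_smul_measure, ENNReal.toReal_inv, smul_eq_mul]
    congr 1
    calc ∫ y in B, φ (x + y) = ∫ y in Metric.closedBall x h, φ y := by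
          rw [← integral_indicator hBm, ← integral_indicator hBx,
            ← integral_add_left_eq_self (μ := volume)
              ((Metric.closedBall x h).indicator φ) x]
          refine integral_congr_ae (ae_of_all _ fun y => ?_)
          simp [Set.indicator, hB]
      _ = ∫ y in Metric.closedBall x h, φ y ∂(volume.restrict Ω) := by
          rw [Measure.restrict_restrict hBx]
          refine setIntegral_eq_of_subset_of_forall_sdiff_eq_zero hBx Set.inter_subset_left
            fun y hy => by_contra fun hne => hy.2 ⟨hy.1, hs hne⟩
      _ = ∫ y in Metric.closedBall x h, w.fst y ∂(volume.restrict Ω) :=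
          integral_congr_ae (ae_restrict_of_ae (h4.mono fun y hy => hy.symm))
  · have key := lintegral_enorm_sq_le_average (μ := volume) (h1.of_le (by simp)) h2 hν Ω
    rwa [← enorm_sq_eq_lintegral_of_ae_eq w.snd h5 ((support_gradient_subset φ).trans h3),
      ← lintegral_congr_ae (f := fun x => ‖w.fst x‖ₑ ^ 2)
        (by filter_upwards [h4] with x hx; rw [hx]), ← enorm_Lp_two_sq] at key

end Sobolev

section Rellich

variable {n : ℕ} {Ω : Set (EuclideanSpace ℝ (Fin n))}

/-- Rellich's theorem for test functions: their means over balls of a fixed small radius tend to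
zero by dominated convergence. -/
lemma tendsto_norm_fst_of_mem_testPairs (hΩ : Bornology.IsBounded Ω) {w : ℕ → SobolevPair Ω}
    (hw : ∀ k, w k ∈ testPairs Ω) {M : ℝ} (hM : ∀ k, ‖w k‖ ≤ M)
    (hweak : ∀ g : L2 Ω, Tendsto (fun k => inner ℝ g (w k).fst) atTop (𝓝 0)) :
    Tendsto (fun k => ‖(w k).fst‖) atTop (𝓝 0) := by
  have hM0 : 0 ≤ M := (norm_nonneg _).trans (hM 0)
  have hfst : ∀ k, ‖(w k).fst‖ ≤ M := fun k => (WithLp.norm_fst_le _ _).trans (hM k)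
  have hsnd : ∀ k, ‖(w k).snd‖ ≤ M := fun k => (WithLp.norm_snd_le _ _).trans (hM k)
  rw [Metric.tendsto_atTop]
  intro ε hε
  -- The oscillation term `2 * (h * M) ^ 2` is at most `ε ^ 2 / 2`.
  obtain ⟨h, hh, hhM⟩ : ∃ h : ℝ, 0 < h ∧ h * M ≤ ε / 2 := by
    refine ⟨ε / (2 * (M + 1)), by positivity, ?_⟩
    rw [div_mul_eq_mul_div, div_le_div_iff₀ (by positivity) (by positivity)]
    nlinarith
  choose m hm hmi hmle using fun k => exists_average_of_mem_testPairs hh (hw k)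
  set V := volume.real (Metric.closedBall (0 : EuclideanSpace ℝ (Fin n)) h) with hV
  have hV0 : 0 ≤ V := measureReal_nonneg
  set K : ℝ := V⁻¹ * (V ^ (1 / 2 : ℝ) * M) with hK
  have hmK : ∀ k x, ‖m k x‖ ≤ K := by
    intro k x
    rw [hmi, norm_mul, Real.norm_of_nonneg (inv_nonneg.2 hV0), hK]
    gcongr
    refine (norm_inner_le_norm _ _).trans ?_
    gcongr
    · exact norm_ballIndicator_le x h
    · exact hfst k
  have hlim : Tendsto (fun k => ∫⁻ x in Ω, ‖m k x‖ₑ ^ 2) atTop (𝓝 0) := by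
    have := tendsto_lintegral_of_dominated_convergence (μ := volume.restrict Ω)
      (F := fun k x => ‖m k x‖ₑ ^ 2) (f := fun _ => 0) (fun _ => ENNReal.ofReal K ^ 2)
      (fun k => ((hm k).enorm).pow_const 2) (fun k => ae_of_all _ fun x => ?_) ?_
      (ae_of_all _ fun x => ?_)
    · simpa using this
    · change ‖m k x‖ₑ ^ 2 ≤ _
      refine pow_le_pow_left₀ zero_le ?_ 2
      rw [← ofReal_norm]
      exact ENNReal.ofReal_le_ofReal (hmK k x)
    · rw [lintegral_const, Measure.restrict_apply_univ]
      exact ENNReal.mul_ne_top (by finiteness) hΩ.measure_lt_top.ne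
    · have h1 : Tendsto (fun k => m k x) atTop (𝓝 0) := by
        simp_rw [hmi]
        simpa using (hweak (ballIndicator Ω x h)).const_mul V⁻¹
      have h2 := ((ENNReal.continuous_pow 2).tendsto _).comp h1.enorm
      simpa [Function.comp_def] using h2
  have hev : ∀ᶠ k in atTop, ∫⁻ x in Ω, ‖m k x‖ₑ ^ 2 < ENNReal.ofReal (ε ^ 2 / 4) :=
    hlim.eventually (gt_mem_nhds (by positivity))
  obtain ⟨N, hN⟩ := eventually_atTop.1 hev
  refine ⟨N, fun k hk => ?_⟩
  have e2 : ∀ r : ℝ, 2 * ENNReal.ofReal r = ENNReal.ofReal (2 * r) := fun r => by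
    rw [ENNReal.ofReal_mul (by norm_num)]
    simp
  have h1 : ‖(w k).fst‖ₑ ^ 2 < ENNReal.ofReal (ε ^ 2) := by
    calc ‖(w k).fst‖ₑ ^ 2
        ≤ 2 * (ENNReal.ofReal h ^ 2 * ‖(w k).snd‖ₑ ^ 2) + 2 * ∫⁻ x in Ω, ‖m k x‖ₑ ^ 2 := hmle k
      _ < ENNReal.ofReal (ε ^ 2 / 2) + ENNReal.ofReal (ε ^ 2 / 2) := by
          refine ENNReal.add_lt_add_of_le_of_lt ?_ ?_ ?_
          · finiteness
          · rw [← ofReal_norm, ← mul_pow, ← ENNReal.ofReal_mul hh.le,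
              ← ENNReal.ofReal_pow (by positivity), e2]
            refine ENNReal.ofReal_le_ofReal ?_
            have : h * ‖(w k).snd‖ ≤ ε / 2 :=
              (mul_le_mul_of_nonneg_left (hsnd k) hh.le).trans hhM
            have h0 : 0 ≤ h * ‖(w k).snd‖ := by positivity
            nlinarith
          · have e4 : ENNReal.ofReal (ε ^ 2 / 2) = 2 * ENNReal.ofReal (ε ^ 2 / 4) := by
              rw [e2]
              congr 1
              ring
            rw [e4]
            exact ENNReal.mul_lt_mul_right (by norm_num) (by norm_num) (hN k hk)
      _ = ENNReal.ofReal (ε ^ 2) := by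
          rw [← ENNReal.ofReal_add (by positivity) (by positivity)]
          congr 1
          ring
  rw [← ofReal_norm, ← ENNReal.ofReal_pow (norm_nonneg _),
    ENNReal.ofReal_lt_ofReal_iff (by positivity)] at h1
  rw [dist_zero_right, norm_norm]
  exact lt_of_pow_lt_pow_left₀ 2 hε.le h1

/-- **Rellich's theorem**, in the form that the inclusion of `H¹₀(Ω)` into `L²(Ω)` is completely
continuous. No regularity of the boundary is needed for functions that vanish there. -/
theorem tendsto_norm_val_of_weak (hΩ : Bornology.IsBounded Ω) {u : ℕ → H10 Ω} {M : ℝ}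
    (hM : ∀ k, ‖u k‖ ≤ M)
    (hweak : ∀ g : L2 Ω, Tendsto (fun k => inner ℝ g (H10.val (u k))) atTop (𝓝 0)) :
    Tendsto (fun k => ‖H10.val (u k)‖) atTop (𝓝 0) := by
  have hδ : ∀ k : ℕ, (0 : ℝ) < 1 / ((k : ℝ) + 1) := fun k => by positivity
  have hex : ∀ k, ∃ w ∈ testPairs Ω, dist (u k : SobolevPair Ω) w < 1 / ((k : ℝ) + 1) := fun k =>
    Metric.mem_closure_iff.1 (H10_eq_closure ▸ (u k).2) _ (hδ k)
  choose w hw hd using hex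
  have hdiff : ∀ k, ‖(w k).fst - H10.val (u k)‖ ≤ 1 / ((k : ℝ) + 1) := by
    intro k
    have := WithLp.norm_fst_le _ (w k - (u k : SobolevPair Ω))
    rw [WithLp.sub_fst, ← dist_eq_norm (w k), dist_comm] at this
    exact this.trans (hd k).le
  have hlim0 : Tendsto (fun k => ‖(w k).fst - H10.val (u k)‖) atTop (𝓝 0) :=
    squeeze_zero (fun _ => norm_nonneg _) hdiff tendsto_one_div_add_atTop_nhds_zero_nat
  have hw0 : Tendsto (fun k => ‖(w k).fst‖) atTop (𝓝 0) := by
    refine tendsto_norm_fst_of_mem_testPairs hΩ hw (M := M + 1) (fun k => ?_) fun g => ?_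
    · have h1 : ‖w k‖ ≤ ‖(u k : SobolevPair Ω)‖ + dist (u k : SobolevPair Ω) (w k) := by
        rw [dist_eq_norm']
        exact norm_le_insert' _ _
      have h2 : 1 / ((k : ℝ) + 1) ≤ 1 := by
        rw [div_le_one (by positivity)]
        simp
      have h3 : ‖(u k : SobolevPair Ω)‖ ≤ M := hM k
      linarith [hd k]
    · have h1 : Tendsto (fun k => inner ℝ g ((w k).fst - H10.val (u k))) atTop (𝓝 0) := by
        refine squeeze_zero_norm (fun k => norm_inner_le_norm _ _) ?_
        simpa using hlim0.const_mul ‖g‖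
      simpa [inner_sub_right] using h1.add (hweak g)
  refine squeeze_zero (fun _ => norm_nonneg _) (fun k => ?_) (by simpa using hw0.add hlim0)
  simpa [norm_sub_rev] using norm_sub_le (w k).fst ((w k).fst - H10.val (u k))

end Rellich

/-! ### Existence of weak solutions -/

section WeakSolution

variable {n : ℕ} {Ω : Set (EuclideanSpace ℝ (Fin n))}

instance : CompleteSpace (H10 Ω) :=
  (Submodule.isClosed_topologicalClosure _).completeSpace_coe

/-- The inclusion of `H¹₀(Ω)` into `L²(Ω)`. -/
noncomputable def valL (Ω : Set (EuclideanSpace ℝ (Fin n))) : H10 Ω →L[ℝ] L2 Ω :=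
  (WithLp.fstL 2 ℝ _ _).comp (H10 Ω).subtypeL

/-- The weak gradient on `H¹₀(Ω)` as a continuous linear map. -/
noncomputable def gradL (Ω : Set (EuclideanSpace ℝ (Fin n))) :
    H10 Ω →L[ℝ] Lp (EuclideanSpace ℝ (Fin n)) 2 (volume.restrict Ω) :=
  (WithLp.sndL 2 ℝ _ _).comp (H10 Ω).subtypeL

lemma valL_apply (u : H10 Ω) : valL Ω u = H10.val u := rfl

lemma norm_sq_eq (u : H10 Ω) : ‖u‖ ^ 2 = ‖H10.val u‖ ^ 2 + ‖H10.grad u‖ ^ 2 :=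
  WithLp.prod_norm_sq_eq_of_L2 (u : SobolevPair Ω)

lemma inner_eq_setIntegral_val (z : L2 Ω) (v : H10 Ω) :
    inner ℝ z (H10.val v) = ∫ x in Ω, z x * H10.val v x := by
  rw [L2.inner_def]
  simp [mul_comm]

/-- The energy form `∫ b ∇u·∇v` as a bounded bilinear form: the inner product with the product of
the class of `b` in `L^∞` and the gradient. -/
lemma exists_energyForm {b : EuclideanSpace ℝ (Fin n) → ℝ}
    (hb : AEMeasurable b (volume.restrict Ω)) {c C : ℝ} (hc : 0 < c)
    (hbd : ∀ᵐ x ∂(volume.restrict Ω), c ≤ b x ∧ b x ≤ C) :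
    ∃ B : H10 Ω →L[ℝ] H10 Ω →L[ℝ] ℝ,
      (∀ u v, B u v = ∫ x in Ω, b x * inner ℝ (H10.grad u x) (H10.grad v x)) ∧
      ∀ u, c * ‖H10.grad u‖ ^ 2 ≤ B u u := by
  have hbm : MemLp b ⊤ (volume.restrict Ω) :=
    memLp_top_of_bound hb.aestronglyMeasurable C (hbd.mono fun x hx => by
      rw [Real.norm_of_nonneg (hc.le.trans hx.1)]
      exact hx.2)
  let T : Lp (EuclideanSpace ℝ (Fin n)) 2 (volume.restrict Ω) →L[ℝ]
      Lp (EuclideanSpace ℝ (Fin n)) 2 (volume.restrict Ω) :=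
    (ContinuousLinearMap.lsmul ℝ ℝ).holderL (volume.restrict Ω) ⊤ 2 2 (hbm.toLp b)
  have hT : ∀ f, ⇑(T f) =ᵐ[volume.restrict Ω] fun x => b x • f x := by
    intro f
    have h1 := ContinuousLinearMap.coeFn_holder (r := 2)
      (ContinuousLinearMap.lsmul ℝ ℝ (E := EuclideanSpace ℝ (Fin n))) (hbm.toLp b) f
    filter_upwards [h1, hbm.coeFn_toLp] with x hx hx'
    rw [← hx']
    exact hx
  let I : Lp (EuclideanSpace ℝ (Fin n)) 2 (volume.restrict Ω) →L[ℝ]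
      Lp (EuclideanSpace ℝ (Fin n)) 2 (volume.restrict Ω) →L[ℝ] ℝ := innerSL ℝ
  have hB : ∀ f g : Lp (EuclideanSpace ℝ (Fin n)) 2 (volume.restrict Ω),
      inner ℝ (T f) g = ∫ x in Ω, b x * inner ℝ (f x) (g x) := by
    intro f g
    rw [L2.inner_def]
    refine integral_congr_ae ((hT f).mono fun x hx => ?_)
    simp only [hx, real_inner_smul_left]
  refine ⟨I.bilinearComp (T.comp (gradL Ω)) (gradL Ω), fun u v => hB _ _, fun u => ?_⟩
  have h1 : c * ‖H10.grad u‖ ^ 2 =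
      ∫ x in Ω, c * inner ℝ (H10.grad u x) (H10.grad u x) := by
    rw [integral_const_mul, ← L2.inner_def, real_inner_self_eq_norm_sq]
  have h2 : Integrable (fun x => b x * inner ℝ (H10.grad u x) (H10.grad u x))
      (volume.restrict Ω) :=
    (L2.integrable_inner (𝕜 := ℝ) (T (H10.grad u)) (H10.grad u)).congr
      ((hT (H10.grad u)).mono fun x hx => by simp only [hx, real_inner_smul_left])
  rw [h1]
  refine (integral_mono_ae ((L2.integrable_inner _ _).const_mul c) h2 ?_).trans_eq (hB _ _).symm
  filter_upwards [hbd] with x hx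
  exact mul_le_mul_of_nonneg_right hx.1 real_inner_self_nonneg

/-- The gradient alone controls the full `H¹` norm on `H¹₀(Ω)`. -/
lemma exists_norm_sq_le_grad (hn : 0 < n) (hΩ : Bornology.IsBounded Ω) :
    ∃ κ : ℝ, 0 < κ ∧ ∀ u : H10 Ω, κ * ‖u‖ ^ 2 ≤ ‖H10.grad u‖ ^ 2 := by
  obtain ⟨C, hC, h⟩ := exists_norm_val_le hn hΩ
  refine ⟨(1 + C ^ 2)⁻¹, by positivity, fun u => ?_⟩
  rw [inv_mul_le_iff₀ (by positivity), norm_sq_eq]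
  have := pow_le_pow_left₀ (norm_nonneg _) (h u) 2
  nlinarith

/-- Coercive variational problems have a continuous linear solution operator. -/
lemma exists_solution_of_coercive {V Z : Type*} [NormedAddCommGroup V] [InnerProductSpace ℝ V]
    [CompleteSpace V] [NormedAddCommGroup Z] [InnerProductSpace ℝ Z] [CompleteSpace Z]
    {B : V →L[ℝ] V →L[ℝ] ℝ} {κ : ℝ} (hκ : 0 < κ) (hB : ∀ u, κ * ‖u‖ ^ 2 ≤ B u u)
    (i : V →L[ℝ] Z) :
    ∃ S : Z →L[ℝ] V, ∀ z u, (∀ v, B u v = inner ℝ z (i v)) ↔ u = S z := by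
  have hco : IsCoercive B := ⟨κ, hκ, fun u => by
    have := hB u
    rwa [sq, ← mul_assoc] at this⟩
  let A := hco.continuousLinearEquivOfBilin
  refine ⟨(A.symm : V →L[ℝ] V).comp i.adjoint, fun z u => ?_⟩
  have hA : ∀ v, B u v = inner ℝ (A u) v := fun v =>
    (hco.continuousLinearEquivOfBilin_apply u v).symm
  have e : u = ((A.symm : V →L[ℝ] V).comp i.adjoint) z ↔ A u = i.adjoint z :=
    A.eq_symm_apply
  rw [e]
  simp only [hA, ← ContinuousLinearMap.adjoint_inner_left]
  exact ⟨fun h => ext_inner_right ℝ h, fun h v => by rw [h]⟩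

/-- The Lax–Milgram theorem for the weak form of `-∇·(b ∇u) = z`. -/
theorem exists_continuousLinear_solution (hn : 0 < n) (hΩ : Bornology.IsBounded Ω)
    {b : EuclideanSpace ℝ (Fin n) → ℝ} (hb : IsUniformlyElliptic Ω b) :
    ∃ (S : L2 Ω →L[ℝ] H10 Ω) (κ : ℝ), 0 < κ ∧
      (∀ z u, IsWeakSolution Ω b z u ↔ u = S z) ∧
      ∀ z, κ * ‖S z‖ ^ 2 ≤ inner ℝ z (H10.val (S z)) := by
  obtain ⟨hbm, c, C, hc, -, hbd⟩ := hb
  obtain ⟨B, hB, hBc⟩ := exists_energyForm hbm hc hbd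
  obtain ⟨κ, hκ, hgrad⟩ := exists_norm_sq_le_grad hn hΩ
  have hle : ∀ u, c * κ * ‖u‖ ^ 2 ≤ B u u := fun u => by
    have := mul_le_mul_of_nonneg_left (hgrad u) hc.le
    linarith [hBc u]
  obtain ⟨S, hS⟩ := exists_solution_of_coercive (by positivity) hle (valL Ω)
  have hsol : ∀ z u, IsWeakSolution Ω b z u ↔ u = S z := fun z u => by
    refine Iff.trans (forall_congr' fun v => ?_) (hS z u)
    rw [hB, valL_apply, inner_eq_setIntegral_val]
  refine ⟨S, c * κ, by positivity, hsol, fun z => ?_⟩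
  have h1 : B (S z) (S z) = inner ℝ z (valL Ω (S z)) := (hS z (S z)).2 rfl (S z)
  exact (hle (S z)).trans_eq h1

/-- For a uniformly elliptic coefficient the defining case distinction of `solutionOperator`
is resolved: its value is the weak solution. -/
lemma isWeakSolution_solutionOperator (hn : 0 < n) (hΩ : Bornology.IsBounded Ω) {Ξ : Type*}
    {a : EuclideanSpace ℝ (Fin n) → Ξ → ℝ} {ξ : Ξ}
    (ha : IsUniformlyElliptic Ω fun x => a x ξ) (z : L2 Ω) :
    IsWeakSolution Ω (fun x => a x ξ) z (solutionOperator Ω a ξ z) := by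
  obtain ⟨S, κ, -, hS, -⟩ := exists_continuousLinear_solution hn hΩ ha
  have h : IsUniformlyElliptic Ω (fun x => a x ξ) ∧
      ∃ u : H10 Ω, IsWeakSolution Ω (fun x => a x ξ) z u := ⟨ha, S z, (hS z _).2 rfl⟩
  rw [solutionOperator, dif_pos h]
  exact h.2.choose_spec

/-! ### Weak convergence of the data -/

lemma WeaklyConverges.tendsto_inner {H : Type*} [NormedAddCommGroup H] [InnerProductSpace ℝ H]
    {y_ε : ℝ → H} {y : H} (h : WeaklyConverges y_ε y) (g : H) :
    Tendsto (fun ε => inner ℝ g (y_ε ε)) (𝓝[>] 0) (𝓝 (inner ℝ g y)) :=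
  ((WeakBilin.eval_continuous (topDualPairing ℝ H).flip (innerSL ℝ g)).tendsto _).comp h

/-- The uniform boundedness principle for weakly convergent sequences. -/
lemma exists_norm_le_of_tendsto_inner {H : Type*} [NormedAddCommGroup H] [InnerProductSpace ℝ H]
    [CompleteSpace H] {w : ℕ → H} {y : H}
    (hw : ∀ g, Tendsto (fun k => inner ℝ g (w k)) atTop (𝓝 (inner ℝ g y))) :
    ∃ M, ∀ k, ‖w k‖ ≤ M := by
  have h : ∀ g, ∃ C, ∀ k, ‖innerSL ℝ (w k) g‖ ≤ C := fun g => by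
    obtain ⟨C, hC⟩ := (Metric.isBounded_range_of_tendsto _ (hw g)).exists_norm_le
    refine ⟨C, fun k => ?_⟩
    rw [innerSL_apply_apply, real_inner_comm]
    exact hC _ ⟨k, rfl⟩
  obtain ⟨M, hM⟩ := banach_steinhaus h
  exact ⟨M, fun k => by simpa using hM k⟩

/-- The solution operator of a uniformly elliptic equation turns weak into strong convergence:
the energy of the solutions is the pairing of the bounded data with solutions that converge
strongly in `L²` by Rellich's theorem. -/
lemma tendsto_solution_of_weak (hΩ : Bornology.IsBounded Ω) {S : L2 Ω →L[ℝ] H10 Ω} {κ : ℝ}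
    (hκ : 0 < κ) (hS : ∀ z, κ * ‖S z‖ ^ 2 ≤ inner ℝ z (H10.val (S z))) {w : ℕ → L2 Ω}
    (hw : ∀ g, Tendsto (fun k => inner ℝ g (w k)) atTop (𝓝 0)) :
    Tendsto (fun k => S (w k)) atTop (𝓝 0) := by
  obtain ⟨M, hM⟩ := exists_norm_le_of_tendsto_inner (w := w) (y := 0) fun g => by
    simpa only [inner_zero_right] using hw g
  have hSM : ∀ k, ‖S (w k)‖ ≤ ‖S‖ * M := fun k =>
    (S.le_opNorm _).trans (mul_le_mul_of_nonneg_left (hM k) (norm_nonneg S))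
  have hval : Tendsto (fun k => ‖H10.val (S (w k))‖) atTop (𝓝 0) := by
    refine tendsto_norm_val_of_weak hΩ hSM fun g => ?_
    refine (hw (((valL Ω).comp S).adjoint g)).congr fun k => ?_
    rw [ContinuousLinearMap.adjoint_inner_left]
    rfl
  have hsq : Tendsto (fun k => ‖S (w k)‖ ^ 2) atTop (𝓝 0) := by
    refine squeeze_zero (fun _ => sq_nonneg _) (fun k => ?_)
      (by simpa using hval.const_mul (κ⁻¹ * M))
    rw [mul_assoc, ← div_eq_inv_mul, le_div_iff₀' hκ]
    refine (hS (w k)).trans ((real_inner_le_norm _ _).trans ?_)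
    exact mul_le_mul_of_nonneg_right (hM k) (norm_nonneg _)
  rw [tendsto_zero_iff_norm_tendsto_zero]
  simpa using hsq.sqrt

theorem tendsto_solutionOperator (hn : 0 < n) (hΩ : Bornology.IsBounded Ω) {Ξ : Type*}
    {a : EuclideanSpace ℝ (Fin n) → Ξ → ℝ} {ξ : Ξ}
    (ha : IsUniformlyElliptic Ω fun x => a x ξ) {z_ε : ℝ → L2 Ω} {z : L2 Ω}
    (hz : WeaklyConverges z_ε z) :
    Tendsto (fun ε => solutionOperator Ω a ξ (z_ε ε)) (𝓝[>] (0 : ℝ))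
      (𝓝 (solutionOperator Ω a ξ z)) := by
  obtain ⟨S, κ, hκ, hS, hSκ⟩ := exists_continuousLinear_solution hn hΩ ha
  have e : ∀ z, solutionOperator Ω a ξ z = S z := fun z =>
    (hS z _).1 (isWeakSolution_solutionOperator hn hΩ ha z)
  simp_rw [e]
  -- A weakly convergent family need not be bounded, but its sequences along `ε ↓ 0` are.
  refine tendsto_of_seq_tendsto fun ε hε => ?_
  rw [← tendsto_sub_nhds_zero_iff]
  refine Tendsto.congr (fun k => map_sub S (z_ε (ε k)) z) ?_
  refine tendsto_solution_of_weak hΩ hκ hSκ fun g => ?_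
  have h := ((hz.tendsto_inner g).comp hε).sub_const (inner ℝ g z)
  rw [sub_self] at h
  exact h.congr fun k => (inner_sub_right _ _ _).symm

end WeakSolution

/-! ### Measurable dependence on the parameter -/

section Measurability

variable {n : ℕ} {Ω : Set (EuclideanSpace ℝ (Fin n))} {Ξ : Type*} [MeasurableSpace Ξ]
  {a : EuclideanSpace ℝ (Fin n) → Ξ → ℝ}

instance : SecondCountableTopology (H10 Ω) := by
  have : Fact ((2 : ENNReal) ≠ ⊤) := ⟨ENNReal.ofNat_ne_top⟩
  have : SecondCountableTopology (L2 Ω) := Lp.SecondCountableTopology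
  have : SecondCountableTopology (Lp (EuclideanSpace ℝ (Fin n)) 2 (volume.restrict Ω)) :=
    Lp.SecondCountableTopology
  have : SecondCountableTopology (SobolevPair Ω) := WithLp.secondCountableTopology 2 _ _
  exact TopologicalSpace.Subtype.secondCountableTopology _

lemma sigmaFinite_comap_subtype_coe (hΩ : IsOpen Ω) :
    SigmaFinite (Measure.comap ((↑) : Ω → EuclideanSpace ℝ (Fin n)) volume) := by
  refine SigmaFinite.of_map _ measurable_subtype_coe.aemeasurable ?_
  rw [map_comap_subtype_coe hΩ.measurableSet]
  infer_instance

lemma measurable_energy (hΩ : IsOpen Ω) (ha : Measurable fun p : Ω × Ξ => a p.1 p.2)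
    (v w : H10 Ω) :
    Measurable fun ξ => ∫ x in Ω, a x ξ * inner ℝ (H10.grad v x) (H10.grad w x) := by
  have := sigmaFinite_comap_subtype_coe hΩ
  simp_rw [← integral_subtype_comap hΩ.measurableSet]
  refine StronglyMeasurable.measurable (StronglyMeasurable.integral_prod_left
    (f := fun (x : Ω) ξ => a x ξ * inner ℝ (H10.grad v x) (H10.grad w x)) ?_)
  have h1 : Measurable fun p : Ω × Ξ => inner ℝ (H10.grad v p.1) (H10.grad w p.1) :=
    ((Lp.stronglyMeasurable _).inner (𝕜 := ℝ) (Lp.stronglyMeasurable _)).measurable.comp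
      (measurable_subtype_coe.comp measurable_fst)
  exact (ha.mul h1).stronglyMeasurable

lemma measurableSet_bounds (hΩ : IsOpen Ω) (ha : Measurable fun p : Ω × Ξ => a p.1 p.2)
    (c C : ℝ) :
    MeasurableSet {ξ | ∀ᵐ x ∂(volume.restrict Ω), c ≤ a x ξ ∧ a x ξ ≤ C} := by
  have := sigmaFinite_comap_subtype_coe hΩ
  simp_rw [ae_restrict_iff_subtype hΩ.measurableSet, ae_iff]
  have hs : MeasurableSet {p : Ω × Ξ | ¬(c ≤ a p.1 p.2 ∧ a p.1 p.2 ≤ C)} :=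
    ((measurableSet_le measurable_const ha).inter (measurableSet_le ha measurable_const)).compl
  exact (measurable_measure_prodMk_right hs) (measurableSet_singleton 0)

/-- The coefficient bounds may be taken from a countable family. For a jointly measurable
coefficient every section is measurable on `Ω`. -/
lemma isUniformlyElliptic_iff_exists_nat (hΩ : IsOpen Ω)
    (ha : Measurable fun p : Ω × Ξ => a p.1 p.2) (ξ : Ξ) :
    IsUniformlyElliptic Ω (fun x => a x ξ) ↔
      ∃ k : ℕ, ∀ᵐ x ∂(volume.restrict Ω), 1 / ((k : ℝ) + 1) ≤ a x ξ ∧ a x ξ ≤ k := by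
  have hm : AEMeasurable (fun x => a x ξ) (volume.restrict Ω) :=
    aemeasurable_restrict_of_measurable_subtype hΩ.measurableSet
      (ha.comp measurable_prodMk_right)
  constructor
  · rintro ⟨-, c, C, hc, -, h⟩
    obtain ⟨k₁, hk₁⟩ := exists_nat_one_div_lt hc
    obtain ⟨k₂, hk₂⟩ := exists_nat_ge C
    refine ⟨max k₁ k₂, h.mono fun x hx => ⟨le_trans ?_ (hk₁.le.trans hx.1), ?_⟩⟩
    · gcongr
      exact le_max_left _ _
    · exact (hx.2.trans hk₂).trans (by exact_mod_cast le_max_right k₁ k₂)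
  · rintro ⟨k, hk⟩
    exact ⟨hm, 1 / ((k : ℝ) + 1), k + 1, by positivity, by positivity,
      hk.mono fun x hx => ⟨hx.1, hx.2.trans (by linarith)⟩⟩

/-- Membership of the solution `u` of a coercive problem in an open set, in terms of residuals: a
point whose residual has dual norm at most `q` is at distance at most `q / κ` from `u`. Only the
constant `κ`, and no upper bound of the form, enters the criterion. -/
lemma mem_iff_exists_residual_le {V : Type*} [NormedAddCommGroup V] [NormedSpace ℝ V]
    {B : V →L[ℝ] V →L[ℝ] ℝ} {κ : ℝ} (hκ : 0 < κ) (hB : ∀ u, κ * ‖u‖ ^ 2 ≤ B u u) {d : ℕ → V}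
    (hd : DenseRange d) {f : V →L[ℝ] ℝ} {u : V} (hu : ∀ v, B u v = f v) {U : Set V}
    (hU : IsOpen U) :
    u ∈ U ↔ ∃ (j : ℕ) (q : ℚ), 0 ≤ (q : ℝ) ∧ Metric.closedBall (d j) (q / κ) ⊆ U ∧
      ∀ l, |B (d j) (d l) - f (d l)| ≤ q * ‖d l‖ := by
  have hres : ∀ v w, B v w - f w = B (v - u) w := fun v w => by
    rw [map_sub, sub_apply, hu]
  simp_rw [hres]
  constructor
  · intro huU
    obtain ⟨ρ, hρ, hball⟩ := Metric.isOpen_iff.1 hU u huU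
    obtain ⟨q, hq0, hq⟩ := exists_rat_btwn (show 0 < κ * (ρ / 2) by positivity)
    have hδ : 0 < min (ρ / 2) (q / (‖B‖ + 1)) := by positivity
    obtain ⟨j, hj⟩ := hd.exists_dist_lt u hδ
    rw [lt_min_iff, dist_comm, dist_eq_norm, lt_div_iff₀ (by positivity),
      lt_div_iff₀ (by positivity : 0 < ‖B‖ + 1)] at hj
    refine ⟨j, q, hq0.le, fun v hv => hball ?_, fun l => ?_⟩
    · have h1 : (q : ℝ) / κ < ρ / 2 := by rwa [div_lt_iff₀' hκ]
      have h2 := dist_triangle v (d j) u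
      rw [dist_eq_norm (d j)] at h2
      rw [Metric.mem_closedBall] at hv
      rw [Metric.mem_ball]
      linarith [hj.1]
    · refine (B.le_opNorm₂ (d j - u) (d l)).trans ?_
      gcongr
      nlinarith [norm_nonneg (d j - u), hj.2]
  · rintro ⟨j, q, hq0, hsub, hq⟩
    refine hsub ?_
    have hall : ∀ w, |B (d j - u) w| ≤ q * ‖w‖ := fun w =>
      (isClosed_le (f := fun w => |B (d j - u) w|) (g := fun w => q * ‖w‖)
        (by fun_prop) (by fun_prop)).closure_subset_iff.2 (Set.range_subset_iff.2 hq) (hd w)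
    rw [Metric.mem_closedBall, dist_comm, dist_eq_norm, le_div_iff₀' hκ]
    have h1 := (hB (d j - u)).trans ((le_abs_self _).trans (hall (d j - u)))
    rcases (norm_nonneg (d j - u)).eq_or_lt with h0 | h0
    · rwa [← h0, mul_zero]
    · exact le_of_mul_le_mul_right (by nlinarith) h0

/-- Measurability of the solution in the parameter. On the set where the coefficient has given
bounds the coercivity constant is fixed, and the preimage of an open set is described by countably
many residual conditions, each of which depends measurably on the parameter. -/
theorem stronglyMeasurable_solutionOperator (hn : 0 < n) (hΩo : IsOpen Ω)
    (hΩ : Bornology.IsBounded Ω) (ha : Measurable fun p : Ω × Ξ => a p.1 p.2) (z : L2 Ω) :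
    StronglyMeasurable fun ξ => solutionOperator Ω a ξ z := by
  obtain ⟨κ, hκ, hgrad⟩ := exists_norm_sq_le_grad hn hΩ
  let d := TopologicalSpace.denseSeq (H10 Ω)
  have hd : DenseRange d := TopologicalSpace.denseRange_denseSeq _
  -- Outside the union of the sets `E k` the solution operator takes its default value `0`.
  let E : ℕ → Set Ξ := fun k =>
    {ξ | ∀ᵐ x ∂(volume.restrict Ω), 1 / ((k : ℝ) + 1) ≤ a x ξ ∧ a x ξ ≤ k}
  have hE : ∀ k, MeasurableSet (E k) := fun k => measurableSet_bounds hΩo ha _ _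
  have hell : ∀ ξ, IsUniformlyElliptic Ω (fun x => a x ξ) ↔ ξ ∈ ⋃ k, E k := fun ξ => by
    rw [isUniformlyElliptic_iff_exists_nat hΩo ha, Set.mem_iUnion]
    rfl
  let R : ℕ → ℕ → Ξ → ℝ := fun j l ξ =>
    (∫ x in Ω, a x ξ * inner ℝ (H10.grad (d j) x) (H10.grad (d l) x)) -
      inner ℝ z (H10.val (d l))
  have hR : ∀ j l, Measurable (R j l) := fun j l =>
    (measurable_energy hΩo ha (d j) (d l)).sub_const _
  borelize ↥(H10 Ω)
  refine Measurable.stronglyMeasurable (measurable_of_isOpen fun U hU => ?_)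
  have hpre : (fun ξ => solutionOperator Ω a ξ z) ⁻¹' U =
      ((⋃ k, E k)ᶜ ∩ {_ξ | (0 : H10 Ω) ∈ U}) ∪
      ⋃ k, E k ∩ ⋃ (j : ℕ) (q : ℚ), {_ξ | 0 ≤ (q : ℝ) ∧
        Metric.closedBall (d j) (q / (1 / ((k : ℝ) + 1) * κ)) ⊆ U} ∩
        ⋂ l, {ξ | |R j l ξ| ≤ q * ‖d l‖} := by
    ext ξ
    by_cases hξ : IsUniformlyElliptic Ω fun x => a x ξ
    · have hmem := (hell ξ).1 hξ
      have key : ∀ k, ξ ∈ E k → (solutionOperator Ω a ξ z ∈ U ↔ ∃ (j : ℕ) (q : ℚ), 0 ≤ (q : ℝ) ∧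
          Metric.closedBall (d j) (q / (1 / ((k : ℝ) + 1) * κ)) ⊆ U ∧
          ∀ l, |R j l ξ| ≤ q * ‖d l‖) := by
        intro k hk
        have hk0 : (0 : ℝ) < 1 / ((k : ℝ) + 1) := by positivity
        obtain ⟨B, hB, hBc⟩ := exists_energyForm hξ.1 hk0 hk
        have hsol := isWeakSolution_solutionOperator hn hΩ hξ z
        have h := mem_iff_exists_residual_le (B := B) (mul_pos hk0 hκ)
          (fun u => by
            have := mul_le_mul_of_nonneg_left (hgrad u) hk0.le
            linarith [hBc u])
          hd (f := (innerSL ℝ z).comp (valL Ω)) (u := solutionOperator Ω a ξ z)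
          (fun v => by
            rw [hB, hsol v, ← inner_eq_setIntegral_val]
            rfl) hU
        rw [h]
        have hRB : ∀ j l, B (d j) (d l) - ((innerSL ℝ z).comp (valL Ω)) (d l) = R j l ξ :=
          fun j l => by
            rw [hB]
            rfl
        simp only [hRB]
      simp only [Set.mem_preimage, Set.mem_union, Set.mem_inter_iff, Set.mem_compl_iff, hmem,
        not_true_eq_false, false_and, false_or]
      constructor
      · intro h
        obtain ⟨k, hk⟩ := Set.mem_iUnion.1 hmem
        obtain ⟨j, q, h1, h2, h3⟩ := (key k hk).1 h
        exact Set.mem_iUnion.2 ⟨k, hk, Set.mem_iUnion₂.2 ⟨j, q, ⟨h1, h2⟩, Set.mem_iInter.2 h3⟩⟩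
      · intro h
        obtain ⟨k, hk, h⟩ := Set.mem_iUnion.1 h
        obtain ⟨j, q, ⟨h1, h2⟩, h3⟩ := Set.mem_iUnion₂.1 h
        exact (key k hk).2 ⟨j, q, h1, h2, Set.mem_iInter.1 h3⟩
    · have h0 : solutionOperator Ω a ξ z = 0 := by
        rw [solutionOperator, dif_neg fun h => hξ h.1]
      have hmem : ∀ k, ξ ∉ E k := fun k hk => hξ ((hell ξ).2 (Set.mem_iUnion.2 ⟨k, hk⟩))
      simp [h0, hmem]
  rw [hpre]
  refine ((MeasurableSet.iUnion hE).compl.inter (MeasurableSet.const _)).union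
    (MeasurableSet.iUnion fun k => (hE k).inter (MeasurableSet.iUnion fun j =>
      MeasurableSet.iUnion fun q => (MeasurableSet.const _).inter (MeasurableSet.iInter fun l =>
        measurableSet_le ?_ measurable_const)))
  exact continuous_abs.measurable.comp (hR j l)

end Measurability

theorem proposition4p2 {n : ℕ} (hn : 0 < n)
    {Ω : Set (EuclideanSpace ℝ (Fin n))} (hΩ : IsBoundedLipschitzDomain Ω)
    {Ξ : Type*} [MeasurableSpace Ξ] (P : Measure Ξ) [IsProbabilityMeasure P]
    (a : EuclideanSpace ℝ (Fin n) → Ξ → ℝ)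
    (ha_ξ : ∀ x ∈ Ω, Measurable (a x))
    (ha_x : ∀ᵐ ξ ∂P, AEMeasurable (fun x => a x ξ) (volume.restrict Ω))
    (a_lower a_upper : ℝ) (h_lower : 0 < a_lower) (h_upper : 0 < a_upper)
    (ha_bounds : ∀ᵐ ξ ∂P, ∀ᵐ x ∂(volume.restrict Ω), a_lower ≤ a x ξ ∧ a x ξ ≤ a_upper) :
    -- almost surely, `s(ξ, z)` is the unique weak solution, for every `z`
    (∀ᵐ ξ ∂P, ∀ (z : L2 Ω) (u : H10 Ω),
      IsWeakSolution Ω (fun x => a x ξ) z u ↔ u = solutionOperator Ω a ξ z) ∧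
    -- weak convergence of the controls gives strong convergence of the states
    (∀ (z_ε : ℝ → L2 Ω) (z : L2 Ω), WeaklyConverges z_ε z →
      ∀ᵐ ξ ∂P, Tendsto (fun ε => solutionOperator Ω a ξ (z_ε ε)) (𝓝[>] (0 : ℝ))
        (𝓝 (solutionOperator Ω a ξ z))) ∧
    -- the standing assumption holds, provided the coefficient is jointly measurable
    ((Measurable fun p : Ω × Ξ => a p.1 p.2) →
      SolutionMapAssumption P (solutionOperator Ω a)) := by
  have hell : ∀ᵐ ξ ∂P, IsUniformlyElliptic Ω fun x => a x ξ := by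
    filter_upwards [ha_x, ha_bounds] with ξ h1 h2
    exact ⟨h1, a_lower, a_upper, h_lower, h_upper, h2⟩
  have hstrong : ∀ (z_ε : ℝ → L2 Ω) (z : L2 Ω), WeaklyConverges z_ε z →
      ∀ᵐ ξ ∂P, Tendsto (fun ε => solutionOperator Ω a ξ (z_ε ε)) (𝓝[>] (0 : ℝ))
        (𝓝 (solutionOperator Ω a ξ z)) := fun z_ε z hz =>
    hell.mono fun ξ hξ => tendsto_solutionOperator hn hΩ.isBounded hξ hz
  refine ⟨?_, hstrong, fun ha => ⟨fun z => ?_, fun z_ε z hz => ?_⟩⟩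
  · filter_upwards [hell] with ξ hξ z u
    obtain ⟨S, κ, -, hS, -⟩ := exists_continuousLinear_solution hn hΩ.isBounded hξ
    rw [hS, (hS z _).1 (isWeakSolution_solutionOperator hn hΩ.isBounded hξ z)]
  · exact stronglyMeasurable_solutionOperator hn hΩ.isOpen hΩ.isBounded ha z
  · filter_upwards [hstrong z_ε z hz] with ξ hξ
    exact ((toWeakSpaceCLM ℝ (H10 Ω)).continuous.tendsto _).comp hξ
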